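/- Let $k$ be an infinite field, let $n\ge 1$, and let $S=k[x_1,\dots,x_n]$ be the standard graded polynomial ring, with the graded reverse lexicographic order with $x_1>x_2>\dots>x_n$. For an ideal $I\subseteq S$, let $\mathrm{in}(I)$ be the ideal generated by the largest monomials of the nonzero elements of $I$. Each $\alpha\in GL_n(k)$ acts on $S$ by the induced linear change of coordinates. The generic initial ideal $\mathrm{gin}(I)$ is the ideal $J$ such that $\mathrm{in}(\alpha(I))=J$ for all $\alpha$ in some nonempty Zariski open subset of $GL_n(k)$. Let $P\subset S$ be a homogeneous prime ideal and let $J=\mathrm{gin}(P)$. If $\mathrm{ht}(J)=1$, then $J=(x_1^e)$ for some integer $e>0$. -/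

import Mathlib

open MvPolynomial

-- the standard grading of the polynomial ring
attribute [local instance] MvPolynomial.gradedAlgebra

/-- Type synonym for exponent vectors of monomials in `x₁, …, xₙ` (indexed by `0, …, n - 1`),
carrying the graded reverse lexicographic order. -/
def DegRevLex (n : ℕ) : Type := Fin n →₀ ℕ

namespace DegRevLex

variable {n : ℕ}

noncomputable instance : AddCommMonoid (DegRevLex n) :=
  inferInstanceAs (AddCommMonoid (Fin n →₀ ℕ))

/-- The identity map, as an additive equivalence. -/
noncomputable def equiv (n : ℕ) : (Fin n →₀ ℕ) ≃+ DegRevLex n := AddEquiv.refl _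

/-- The comparison key: first the total degree, then the exponents read from the last variable
to the first one, compared lexicographically in the reversed sense. -/
noncomputable def key (a : DegRevLex n) : ℕ ×ₗ (Lex (Fin n → ℕ))ᵒᵈ :=
  toLex (((equiv n).symm a).degree,
    OrderDual.toDual (toLex (fun i => (equiv n).symm a i.rev)))

theorem key_injective : Function.Injective (key (n := n)) := by
  intro a b h
  have h2 := congrArg (fun z => ofLex (OrderDual.ofDual (ofLex z).2)) h
  apply (equiv n).symm.injective
  ext i
  have := congrFun h2 i.rev
  simpa [key] using this

noncomputable instance : LinearOrder (DegRevLex n) := LinearOrder.lift' key key_injective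

theorem lt_iff_key {a b : DegRevLex n} : a < b ↔ key a < key b := Iff.rfl

/-- `u < v` in the graded reverse lexicographic order iff `deg u < deg v`, or `deg u = deg v` and,
at the last variable where the exponents differ, the exponent of `u` is the larger one. -/
theorem lt_iff {a b : Fin n →₀ ℕ} : equiv n a < equiv n b ↔
    a.degree < b.degree ∨
      (a.degree = b.degree ∧ ∃ i, (∀ j, i < j → a j = b j) ∧ b i < a i) := by
  rw [lt_iff_key, key, key, Prod.Lex.toLex_lt_toLex]
  simp only [AddEquiv.symm_apply_apply, OrderDual.toDual_lt_toDual]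
  refine or_congr Iff.rfl (and_congr Iff.rfl ?_)
  constructor
  · rintro ⟨i, h1, h2⟩
    refine ⟨i.rev, fun j hj => ?_, by simpa using h2⟩
    have := h1 j.rev (by rwa [Fin.rev_lt_iff] at hj)
    simpa using this.symm
  · rintro ⟨i, h1, h2⟩
    refine ⟨i.rev, fun j hj => ?_, by simpa using h2⟩
    have := h1 j.rev (Fin.lt_rev_iff.mp hj)
    simpa using this.symm

instance : IsOrderedAddMonoid (DegRevLex n) where
  add_le_add_left a b hab c := by
    rcases hab.eq_or_lt with rfl | h
    · exact le_rfl
    · apply le_of_lt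
      obtain ⟨a, rfl⟩ := (equiv n).surjective a
      obtain ⟨b, rfl⟩ := (equiv n).surjective b
      obtain ⟨c, rfl⟩ := (equiv n).surjective c
      rw [← map_add, ← map_add, lt_iff]
      rw [lt_iff] at h
      simpa using h

theorem equiv_monotone : Monotone (equiv n) := by
  intro a b hab
  obtain ⟨c, rfl⟩ := le_iff_exists_add.mp hab
  rw [map_add]
  suffices h : equiv n 0 ≤ equiv n c by simpa using add_le_add_right h (equiv n a)
  by_cases hc : c = 0
  · rw [hc]
  · refine (lt_iff.mpr (Or.inl ?_)).le
    rw [map_zero]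
    exact Nat.pos_of_ne_zero (by rwa [Ne, Finsupp.degree_eq_zero_iff])

instance : WellFoundedLT (DegRevLex n) := by
  have : WellQuasiOrderedLE (DegRevLex n) := ⟨fun f => by
    obtain ⟨i, j, hij, h⟩ := wellQuasiOrdered_le (fun m => (equiv n).symm (f m))
    exact ⟨i, j, hij, by simpa using equiv_monotone h⟩⟩
  infer_instance

end DegRevLex

/-- The graded reverse lexicographic order with `x₁ > x₂ > ⋯ > xₙ`. -/
noncomputable def degRevLex (n : ℕ) : MonomialOrder (Fin n) where
  syn := DegRevLex n
  toSyn := DegRevLex.equiv n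
  toSyn_monotone := DegRevLex.equiv_monotone

/-- The initial ideal: generated by the largest monomials of the nonzero elements of `I`. -/
noncomputable def initialIdeal {n : ℕ} {k : Type*} [Field k] (m : MonomialOrder (Fin n))
    (I : Ideal (MvPolynomial (Fin n) k)) : Ideal (MvPolynomial (Fin n) k) :=
  Ideal.span {u | ∃ f ∈ I, f ≠ 0 ∧ u = monomial (m.degree f) 1}

/-- The linear change of coordinates of `k[x₁, …, xₙ]` induced by a matrix `α ∈ GLₙ(k)`:
`x_j ↦ ∑ i, α i j * x_i`. -/
noncomputable def linearChange {n : ℕ} {k : Type*} [Field k] (α : GL (Fin n) k) :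
    MvPolynomial (Fin n) k →ₐ[k] MvPolynomial (Fin n) k :=
  aeval (fun j => ∑ i, C (α i j) * X i)

/-- `U ⊆ GLₙ(k)` is Zariski open: it is the complement of the common zero locus of a set of
polynomials in the matrix entries. -/
def IsZariskiOpen {n : ℕ} {k : Type*} [Field k] (U : Set (GL (Fin n) k)) : Prop :=
  ∃ T : Set (MvPolynomial (Fin n × Fin n) k),
    U = {α | ∃ p ∈ T, eval (fun ij => α ij.1 ij.2) p ≠ 0}

/-- `J = gin(I)`: the generic initial ideal with respect to the graded reverse lexicographic order,
that is, `J` is the initial ideal of `α(I)` for all `α` in some nonempty Zariski open subset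
of `GLₙ(k)`. -/
def IsGin {n : ℕ} {k : Type*} [Field k] (J I : Ideal (MvPolynomial (Fin n) k)) : Prop :=
  ∃ U : Set (GL (Fin n) k), IsZariskiOpen U ∧ U.Nonempty ∧
    ∀ α ∈ U, initialIdeal (degRevLex n) (I.map (linearChange α)) = J

/-!
If `J = gin(P)` has height one, it lies in some `(xᵢ)`: a height-one prime over `J` contains a
variable, hence is generated by it. So `xᵢ` divides the leading monomial of every nonzero element
of `α(P)` for generic `α`; in particular `α(P)` meets `k[xⱼ : j ≠ i]` only in zero, which forces
the prime `α(P)` to have height one and so, by unique factorization, to be principal. Finally, for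
`P = (f)` with `f` of degree `d`, the coefficient of `x₁ ^ d` in `α(f)` is the value of the top
form of `f` at the first row of `α`. It is nonzero for generic `α`, and `x₁ ^ d` is the largest
monomial of degree at most `d`.
-/

section Height

theorem height_le_one_of_comap_C_eq_bot {R : Type*} [CommRing R] [IsDomain R]
    {Q : Ideal (Polynomial R)} [Q.IsPrime] (hQ : Q.comap Polynomial.C = ⊥) : Q.height ≤ 1 := by
  let K := FractionRing R
  let _ : Algebra (Polynomial R) (Polynomial K) := Polynomial.algebra R K
  let M := (nonZeroDivisors R).map Polynomial.C
  have : IsLocalization M (Polynomial K) := Polynomial.isLocalization (nonZeroDivisors R) K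
  have hdisj : Disjoint (M : Set (Polynomial R)) Q := by
    refine Set.disjoint_left.mpr ?_
    rintro _ ⟨r, hr, rfl⟩ hrQ
    exact nonZeroDivisors.ne_zero hr (hQ.le hrQ)
  have := IsLocalization.isPrime_of_isPrime_disjoint M (Polynomial K) Q ‹_› hdisj
  rw [← IsLocalization.height_map_of_disjoint (S := Polynomial K) M Q hdisj]
  exact_mod_cast Ideal.height_le_ringKrullDim_of_isPrime.trans
    (Order.krullDimLE_iff 1 _ |>.mp inferInstance)

variable {σ R : Type*} [CommRing R] [IsDomain R]

theorem height_le_one_of_comap_rename_eq_bot (i : σ) {Q : Ideal (MvPolynomial σ R)} [Q.IsPrime]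
    (hQ : Q.comap (rename ((↑) : {j // j ≠ i} → σ) : _ →ₐ[R] _) = ⊥) : Q.height ≤ 1 := by
  classical
  let e : MvPolynomial σ R ≃ₐ[R] Polynomial (MvPolynomial {j // j ≠ i} R) :=
    (renameEquiv R (Equiv.optionSubtypeNe i).symm).trans (optionEquivLeft R _)
  have he : (e.symm.toRingEquiv : Polynomial _ →+* MvPolynomial σ R).comp Polynomial.C =
      (rename ((↑) : {j // j ≠ i} → σ) : _ →ₐ[R] _).toRingHom := by
    ext <;> simp [e, optionEquivLeft_symm_C_X]
  rw [← e.toRingEquiv.symm.height_comap]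
  refine height_le_one_of_comap_C_eq_bot ?_
  rw [← hQ]
  exact (Ideal.comap_comap _ _).trans (congrArg (Q.comap ·) he)

theorem exists_le_span_X_of_height_eq_one {I : Ideal (MvPolynomial σ R)} (hI : I.height = 1)
    {a : σ →₀ ℕ} (ha : monomial a 1 ∈ I) : ∃ i, I ≤ Ideal.span {X i} := by
  obtain ⟨p, hp, hIp, hp1⟩ := Ideal.exists_isPrime_height_eq (n := 1) (by simpa using hI)
  obtain ⟨i, -, hi⟩ : ∃ i ∈ a.support, X i ^ a i ∈ p := by
    have hprod := hIp ha
    rwa [monomial_eq, map_one, one_mul, Finsupp.prod, hp.prod_mem_iff] at hprod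
  refine ⟨i, hIp.trans_eq ?_⟩
  exact p.eq_span_singleton_of_height_eq_one (by simpa using hp1) (hp.mem_of_pow_mem _ hi) X_prime

end Height

section InitialIdeal

variable {n : ℕ} {k : Type*} [Field k] (m : MonomialOrder (Fin n))

theorem initialIdeal_bot : initialIdeal m (⊥ : Ideal (MvPolynomial (Fin n) k)) = ⊥ := by
  rw [initialIdeal, Ideal.span_eq_bot]
  rintro _ ⟨f, hf, hf0, -⟩
  exact absurd hf hf0

theorem monomial_degree_mem_initialIdeal {I : Ideal (MvPolynomial (Fin n) k)}
    {f : MvPolynomial (Fin n) k} (hf : f ∈ I) (hf0 : f ≠ 0) :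
    monomial (m.degree f) 1 ∈ initialIdeal m I :=
  Ideal.subset_span ⟨f, hf, hf0, rfl⟩

theorem initialIdeal_span_singleton {f : MvPolynomial (Fin n) k} (hf : f ≠ 0) :
    initialIdeal m (Ideal.span {f}) = Ideal.span {monomial (m.degree f) 1} := by
  apply le_antisymm
  · rw [initialIdeal, Ideal.span_le]
    rintro _ ⟨g, hg, hg0, rfl⟩
    obtain ⟨h, rfl⟩ := Ideal.mem_span_singleton.mp hg
    rw [SetLike.mem_coe, Ideal.mem_span_singleton, m.degree_mul hf (right_ne_zero_of_mul hg0)]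
    exact ⟨monomial (m.degree h) 1, by rw [monomial_mul, one_mul]⟩
  · rw [Ideal.span_singleton_le_iff_mem]
    exact monomial_degree_mem_initialIdeal m (Ideal.mem_span_singleton_self f) hf

variable {m}

theorem comap_rename_eq_bot_of_initialIdeal_le_span_X {I : Ideal (MvPolynomial (Fin n) k)}
    {i : Fin n} (hi : initialIdeal m I ≤ Ideal.span {X i}) :
    I.comap (rename ((↑) : {j // j ≠ i} → Fin n) : _ →ₐ[k] _) = ⊥ := by
  refine eq_bot_iff.mpr fun g hg => ?_
  by_contra hg0
  have hne : rename ((↑) : {j // j ≠ i} → Fin n) g ≠ 0 :=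
    (map_ne_zero_iff _ (rename_injective _ Subtype.val_injective)).mpr hg0
  have hdvd : X i ∣ monomial (m.degree (rename (↑) g)) (1 : k) :=
    Ideal.mem_span_singleton.mp (hi (monomial_degree_mem_initialIdeal m hg hne))
  have hvars : i ∈ (rename ((↑) : {j // j ≠ i} → Fin n) g).vars :=
    (mem_vars_iff_mem_support i).mpr
      ⟨_, m.degree_mem_support hne, by simpa [X_dvd_monomial] using hdvd⟩
  obtain ⟨j, -, hj⟩ := mem_vars_rename _ _ hvars
  exact j.2 hj

theorem isPrincipal_of_height_initialIdeal_eq_one {Q : Ideal (MvPolynomial (Fin n) k)} [Q.IsPrime]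
    (h : (initialIdeal m Q).height = 1) : Q.IsPrincipal := by
  have hQ : Q ≠ ⊥ := by
    rintro rfl
    simp [initialIdeal_bot] at h
  obtain ⟨f, hf, hf0⟩ := Submodule.exists_mem_ne_zero_of_ne_bot hQ
  obtain ⟨i, hi⟩ :=
    exists_le_span_X_of_height_eq_one h (monomial_degree_mem_initialIdeal m hf hf0)
  have hle : Q.height ≤ 1 :=
    height_le_one_of_comap_rename_eq_bot i (comap_rename_eq_bot_of_initialIdeal_le_span_X hi)
  have hge : 1 ≤ Q.height :=
    Order.one_le_iff_ne_zero.mpr (Ideal.height_eq_zero_iff_eq_bot.not.mpr hQ)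
  exact UniqueFactorizationMonoid.isPrincipal_of_height_eq_one (hle.antisymm hge)

end InitialIdeal

section HomogeneousComponent

variable {σ τ R : Type*} [CommSemiring R]

theorem homogeneousComponent_totalDegree_ne_zero {f : MvPolynomial σ R} (hf : f ≠ 0) :
    homogeneousComponent f.totalDegree f ≠ 0 := by
  obtain ⟨a, ha, hdeg⟩ := f.support.exists_mem_eq_sup (support_nonempty.mpr hf) Finsupp.degree
  have hmem : a ∈ (homogeneousComponent f.totalDegree f).support := by
    rw [support_homogeneousComponent, Finset.mem_filter]
    exact ⟨ha, hdeg.symm⟩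
  exact support_nonempty.mp ⟨a, hmem⟩

theorem homogeneousComponent_aeval_of_isHomogeneous_one {g : σ → MvPolynomial τ R}
    (hg : ∀ i, (g i).IsHomogeneous 1) (d : ℕ) (f : MvPolynomial σ R) :
    homogeneousComponent d (aeval g f) = aeval g (homogeneousComponent d f) := by
  induction f using MvPolynomial.induction_on' with
  | monomial a c =>
    have hmon : (monomial a c).IsHomogeneous a.degree := isHomogeneous_monomial c rfl
    have haeval : (aeval g (monomial a c)).IsHomogeneous a.degree := by
      simpa using hmon.aeval g hg
    rw [homogeneousComponent_of_mem haeval, homogeneousComponent_of_mem hmon, apply_ite (aeval g),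
      map_zero]
  | add p q hp hq => simp only [map_add, hp, hq]

theorem totalDegree_aeval_le_of_isHomogeneous_one {g : σ → MvPolynomial τ R}
    (hg : ∀ i, (g i).IsHomogeneous 1) (f : MvPolynomial σ R) :
    (aeval g f).totalDegree ≤ f.totalDegree := by
  refine Finset.sup_le fun a ha => not_lt.mp fun hlt => ?_
  have hzero : homogeneousComponent a.degree (aeval g f) = 0 := by
    rw [homogeneousComponent_aeval_of_isHomogeneous_one hg,
      homogeneousComponent_eq_zero a.degree f hlt, map_zero]
  apply mem_support_iff.mp ha
  simpa [coeff_homogeneousComponent] using congrArg (coeff a) hzero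

theorem eq_single_degree_of_forall_ne_eq_zero {i : σ} {a : σ →₀ ℕ} (ha : ∀ j ≠ i, a j = 0) :
    a = Finsupp.single i a.degree := by
  have h : a = Finsupp.single i (a i) := by
    ext j
    by_cases hj : j = i
    · rw [hj, Finsupp.single_eq_same]
    · rw [ha j hj, Finsupp.single_eq_of_ne hj]
  rw [h, Finsupp.degree_single]

theorem eval_single_homogeneousComponent [DecidableEq σ] (i : σ) (d : ℕ) (f : MvPolynomial σ R) :
    eval (Pi.single i 1) (homogeneousComponent d f) = coeff (Finsupp.single i d) f := by
  induction f using MvPolynomial.induction_on' with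
  | monomial a c =>
    rw [homogeneousComponent_of_mem (isHomogeneous_monomial c rfl), coeff_monomial]
    by_cases ha : a = Finsupp.single i d
    · simp [ha, eval_monomial]
    · rw [if_neg ha]
      split_ifs with hd
      · obtain ⟨j, hji, hj⟩ : ∃ j ≠ i, a j ≠ 0 := by
          by_contra! h
          exact ha (hd ▸ eq_single_degree_of_forall_ne_eq_zero h)
        have hfactor : (Pi.single i 1 : σ → R) j ^ a j = 0 := by simp [hji, hj]
        rw [eval_monomial, Finsupp.prod, Finset.prod_eq_zero (Finsupp.mem_support_iff.mpr hj)
          hfactor, mul_zero]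
      · exact map_zero _
  | add p q hp hq => simp only [map_add, coeff_add, hp, hq]

end HomogeneousComponent

section LinearChange

variable {n : ℕ} {k : Type*} [Field k]

theorem linearChange_eq_bind₁ (α : GL (Fin n) k) :
    linearChange α = bind₁ (α.val.transpose.toMvPolynomial) := by
  ext j : 1
  simp [linearChange, Matrix.toMvPolynomial, C_mul_X_eq_monomial]

theorem linearChange_comp (α β : GL (Fin n) k) :
    (linearChange α).comp (linearChange β) = linearChange (α * β) := by
  ext j : 1
  simp [linearChange_eq_bind₁, Matrix.transpose_mul, Matrix.toMvPolynomial_mul]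

theorem linearChange_one : linearChange (1 : GL (Fin n) k) = AlgHom.id k _ := by
  ext j : 1
  simp [linearChange_eq_bind₁]

/-- The linear change of coordinates `linearChange α`, as an automorphism of `k[x₁, …, xₙ]`. -/
noncomputable def linearChangeEquiv (α : GL (Fin n) k) :
    MvPolynomial (Fin n) k ≃ₐ[k] MvPolynomial (Fin n) k :=
  AlgEquiv.ofAlgHom (linearChange α) (linearChange α⁻¹)
    (by rw [linearChange_comp, mul_inv_cancel, linearChange_one])
    (by rw [linearChange_comp, inv_mul_cancel, linearChange_one])

theorem linearChange_ne_zero {f : MvPolynomial (Fin n) k} (α : GL (Fin n) k) (hf : f ≠ 0) :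
    linearChange α f ≠ 0 :=
  (map_ne_zero_iff _ (linearChangeEquiv α).injective).mpr hf

theorem isPrime_map_linearChange (α : GL (Fin n) k) (I : Ideal (MvPolynomial (Fin n) k))
    [I.IsPrime] : (I.map (linearChange α)).IsPrime :=
  Ideal.map_isPrime_of_equiv (linearChangeEquiv α)

theorem isPrincipal_of_map_linearChange {α : GL (Fin n) k} {I : Ideal (MvPolynomial (Fin n) k)}
    (hI : (I.map (linearChange α)).IsPrincipal) : I.IsPrincipal := by
  have h := hI.map_ringHom (linearChangeEquiv α).symm
  rwa [show (I.map (linearChange α)).map (linearChangeEquiv α).symm = I from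
    Ideal.map_of_equiv (linearChangeEquiv α).toRingEquiv] at h

theorem eval_linearChange (α : GL (Fin n) k) (v : Fin n → k) (f : MvPolynomial (Fin n) k) :
    eval v (linearChange α f) = eval (Matrix.vecMul v α.val) f := by
  have hv : (fun i => eval v (α.val.transpose.toMvPolynomial i)) = Matrix.vecMul v α.val := by
    simp only [Matrix.toMvPolynomial_eval_eq_apply, Matrix.mulVec_transpose]
  rw [linearChange_eq_bind₁, ← hv]
  exact eval₂Hom_bind₁ (RingHom.id k) v _ f

theorem homogeneousComponent_linearChange (α : GL (Fin n) k) (d : ℕ)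
    (f : MvPolynomial (Fin n) k) :
    homogeneousComponent d (linearChange α f) = linearChange α (homogeneousComponent d f) := by
  rw [linearChange_eq_bind₁]
  exact homogeneousComponent_aeval_of_isHomogeneous_one
    (Matrix.toMvPolynomial_isHomogeneous _) d f

theorem totalDegree_linearChange_le (α : GL (Fin n) k) (f : MvPolynomial (Fin n) k) :
    (linearChange α f).totalDegree ≤ f.totalDegree := by
  rw [linearChange_eq_bind₁]
  exact totalDegree_aeval_le_of_isHomogeneous_one (Matrix.toMvPolynomial_isHomogeneous _) f

theorem coeff_single_linearChange (α : GL (Fin n) k) (i : Fin n) (d : ℕ)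
    (f : MvPolynomial (Fin n) k) :
    coeff (Finsupp.single i d) (linearChange α f) = eval (α i) (homogeneousComponent d f) := by
  rw [← eval_single_homogeneousComponent, homogeneousComponent_linearChange, eval_linearChange,
    Matrix.single_one_vecMul]
  rfl

end LinearChange

section LeadingMonomial

variable {n : ℕ} [NeZero n]

theorem degRevLex_le_single {a : Fin n →₀ ℕ} {d : ℕ} (ha : a.degree ≤ d) :
    (degRevLex n).toSyn a ≤ (degRevLex n).toSyn (Finsupp.single 0 d) := by
  change DegRevLex.equiv n a ≤ DegRevLex.equiv n (Finsupp.single 0 d)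
  rw [← not_lt, DegRevLex.lt_iff, Finsupp.degree_single]
  rintro (hlt | ⟨hdeg, i, hi, hlt⟩)
  · exact hlt.not_ge ha
  · obtain rfl : i = 0 := by
      by_contra hi0
      simp [Finsupp.single_eq_of_ne hi0] at hlt
    have hpow : a = Finsupp.single 0 d := hdeg ▸ eq_single_degree_of_forall_ne_eq_zero
      fun j hj => by rw [← hi j (Fin.pos_iff_ne_zero.mpr hj), Finsupp.single_eq_of_ne hj]
    exact hlt.ne (by rw [hpow])

theorem degRevLex_degree_eq_single {R : Type*} [CommSemiring R] {f : MvPolynomial (Fin n) R}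
    {d : ℕ} (hd : f.totalDegree ≤ d) (hcoeff : coeff (Finsupp.single 0 d) f ≠ 0) :
    (degRevLex n).degree f = Finsupp.single 0 d := by
  apply (degRevLex n).toSyn.injective
  apply le_antisymm
  · exact (degRevLex n).degree_le_iff.mpr fun a ha =>
      degRevLex_le_single ((le_totalDegree ha).trans hd)
  · exact (degRevLex n).le_degree (mem_support_iff.mpr hcoeff)

end LeadingMonomial

section Gin

variable {n : ℕ} {k : Type*} [Field k]

theorem IsZariskiOpen.exists_mem_eval_ne_zero [Infinite k] {U : Set (GL (Fin n) k)}
    (hU : IsZariskiOpen U) (hne : U.Nonempty) {F : MvPolynomial (Fin n × Fin n) k} (hF : F ≠ 0) :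
    ∃ α ∈ U, eval (fun ij => α ij.1 ij.2) F ≠ 0 := by
  obtain ⟨T, rfl⟩ := hU
  obtain ⟨β, p, hpT, hp⟩ := hne
  have hp0 : p ≠ 0 := by
    rintro rfl
    exact hp (map_zero _)
  obtain ⟨α, hα⟩ : ∃ α : GL (Fin n) k, eval (fun ij => α ij.1 ij.2) (p * F) ≠ 0 := by
    by_contra! h
    exact mul_ne_zero hp0 hF (eq_of_eval_eq_on_gl fun α => (h α).trans (map_zero _).symm)
  rw [map_mul] at hα
  exact ⟨α, ⟨p, hpT, left_ne_zero_of_mul hα⟩, right_ne_zero_of_mul hα⟩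

theorem IsZariskiOpen.exists_mem_eval_row_ne_zero [Infinite k] {U : Set (GL (Fin n) k)}
    (hU : IsZariskiOpen U) (hne : U.Nonempty) (i : Fin n) {F : MvPolynomial (Fin n) k}
    (hF : F ≠ 0) : ∃ α ∈ U, eval (α i) F ≠ 0 := by
  have hF' : rename (fun j => (i, j)) F ≠ 0 :=
    (map_ne_zero_iff _ (rename_injective _ (Prod.mk_right_injective i))).mpr hF
  simpa only [eval_rename] using! hU.exists_mem_eval_ne_zero hne hF'

theorem IsGin.isPrincipal_of_height_eq_one {P J : Ideal (MvPolynomial (Fin n) k)}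
    [P.IsPrime] (hJ : IsGin J P) (hht : J.height = 1) : P.IsPrincipal := by
  obtain ⟨U, -, ⟨α, hα⟩, hgin⟩ := hJ
  have := isPrime_map_linearChange α P
  exact isPrincipal_of_map_linearChange
    (isPrincipal_of_height_initialIdeal_eq_one ((congrArg Ideal.height (hgin α hα)).trans hht))

theorem IsGin.eq_bot {J : Ideal (MvPolynomial (Fin n) k)} (hJ : IsGin J ⊥) : J = ⊥ := by
  obtain ⟨U, -, ⟨α, hα⟩, hgin⟩ := hJ
  rw [← hgin α hα, Ideal.map_bot, initialIdeal_bot]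

theorem IsGin.eq_span_X_pow [Infinite k] [NeZero n] {J : Ideal (MvPolynomial (Fin n) k)}
    {f : MvPolynomial (Fin n) k} (hJ : IsGin J (Ideal.span {f})) (hf : f ≠ 0) :
    J = Ideal.span {X 0 ^ f.totalDegree} := by
  obtain ⟨U, hU, hne, hgin⟩ := hJ
  obtain ⟨α, hα, heval⟩ :=
    hU.exists_mem_eval_row_ne_zero hne 0 (homogeneousComponent_totalDegree_ne_zero hf)
  have hdegree : (degRevLex n).degree (linearChange α f) = Finsupp.single 0 f.totalDegree :=
    degRevLex_degree_eq_single (totalDegree_linearChange_le α f)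
      (by rwa [coeff_single_linearChange])
  rw [← hgin α hα, Ideal.map_span, Set.image_singleton,
    initialIdeal_span_singleton _ (linearChange_ne_zero α hf), hdegree, X_pow_eq_monomial]

end Gin

theorem corollary6p2_general {k : Type*} [Field k] [Infinite k] {n : ℕ} [NeZero n]
    {P J : Ideal (MvPolynomial (Fin n) k)} (hP : P.IsPrime) (hJ : IsGin J P)
    (hht : J.height = 1) :
    ∃ e : ℕ, 0 < e ∧ J = Ideal.span {(X 0 : MvPolynomial (Fin n) k) ^ e} := by
  obtain ⟨f, rfl⟩ := hJ.isPrincipal_of_height_eq_one hht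
  have hf : f ≠ 0 := by
    rintro rfl
    have hbot := IsGin.eq_bot (by simpa using hJ)
    simp [hbot] at hht
  have hspan := hJ.eq_span_X_pow hf
  refine ⟨f.totalDegree, Nat.pos_of_ne_zero fun hd => ?_, hspan⟩
  have htop : J = ⊤ := by rw [hspan, hd, pow_zero, Ideal.span_singleton_one]
  simp [htop] at hht

theorem corollary6p2 {k : Type*} [Field k] [Infinite k] {n : ℕ} [NeZero n]
    (P J : Ideal (MvPolynomial (Fin n) k)) (hP : P.IsPrime)
    (hPhom : P.IsHomogeneous (MvPolynomial.homogeneousSubmodule (Fin n) k))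
    (hJ : IsGin J P) (hht : J.height = 1) :
    ∃ e : ℕ, 0 < e ∧ J = Ideal.span {(MvPolynomial.X 0 : MvPolynomial (Fin n) k) ^ e} := by
  exact corollary6p2_general hP hJ hht
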